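/- Let $(\mathcal C,J)$ be a site, i.e. a small category $\mathcal C$ with a Grothendieck topology $J$. A sieve $S$ on an object $c$ is called $J$-closed if every arrow $f:d\to c$ with $f^{*}(S)\in J(d)$ belongs to $S$. For sieves $T\subseteq S$ on $c$, say that $T$ is $J$-dense in $S$ if $f^{*}(T)\in J(\mathrm{dom}(f))$ for every $f\in S$. A sieve $S$ on $c$ is called $J$-indecomposable if for every (possibly empty) set-indexed family $\{S_i \mid i\in I\}$ of sieves $S_i\subseteq S$ on $c$ such that $\emptyset\in J(\mathrm{dom}(f))$ for all distinct $i,i'\in I$ and all $f\in S_i\cap S_{i'}$: if the union $\bigcup_{i\in I}S_i$ is $J$-dense in $S$, then some $S_i$ is $J$-dense in $S$. Theorem. The topos $\mathbf{Sh}(\mathcal C,J)$ of sheaves of sets is locally connected (that is, the inverse image functor $\mathbf{Set}\to\mathbf{Sh}(\mathcal C,J)$ of the unique geometric morphism to $\mathbf{Set}$, i.e. the constant-sheaf functor, has a left adjoint) if and only if for every object $c$ of $\mathcal C$ there exists a set-indexed family $\{S_i\mid i\in I\}$ of $J$-closed $J$-indecomposable sieves on $c$ whose union $\bigcup_{i\in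 I}S_i$ is $J$-covering, i.e. belongs to $J(c)$. -/

import Mathlib

open CategoryTheory

universe u

/-- The topos of sheaves of sets on a small site is locally connected: the inverse image functor of
the geometric morphism to the category of sets, that is, the constant sheaf functor (the left
adjoint of global sections), has itself a left adjoint. -/
def IsLocallyConnectedSheafTopos {C : Type u} [SmallCategory C]
    (J : GrothendieckTopology C) : Prop :=
  (constantSheaf J (Type u)).IsRightAdjoint

/-- A subsieve `T` of `S` is dense in `S` for the closure operation of `J`. -/
def IsDenseIn {C : Type u} [SmallCategory C] (J : GrothendieckTopology C) {c : C}
    (T S : Sieve c) : Prop :=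
  ∀ ⦃d : C⦄ (f : d ⟶ c), S f → T.pullback f ∈ J d

/-- `J`-indecomposable sieves. The index set `I` may be empty. Since `C` is small, `Sieve c` is
itself in `Type u`. -/
def IsIndecomposableSieve {C : Type u} [SmallCategory C] (J : GrothendieckTopology C) {c : C}
    (S : Sieve c) : Prop :=
  ∀ (I : Type u) (T : I → Sieve c),
    (∀ i, T i ≤ S) →
    (∀ i j, i ≠ j → ∀ ⦃d : C⦄ (f : d ⟶ c), T i f → T j f → (⊥ : Sieve d) ∈ J d) →
    IsDenseIn J (⨆ i, T i) S →
    ∃ i, IsDenseIn J (T i) S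

open Opposite Limits

/-! A section over `c` of the constant sheaf on `B` amounts to a partition of `c`, up to covering,
into closed sieves indexed by `B` (`valueSieve`). An indecomposable sieve lies in a single piece.
Hence if such sieves cover `c`, sections over `c` are maps to `B` from the set of their connected
components; this functor of `B` is corepresentable, so the constant sheaf functor preserves limits
and the special adjoint functor theorem applies. Conversely, a left adjoint yields a universal
section over each `c`, whose nondegenerate pieces cannot be split further. -/

/-- The section of the constant sheaf on `B` over `c` with constant value `b`. -/
noncomputable def constSection {C : Type u} [SmallCategory C] (J : GrothendieckTopology C)
    {B : Type u} (c : C) (b : B) : ((constantSheaf J (Type u)).obj B).obj.obj (op c) :=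
  (toSheafify J ((Functor.const Cᵒᵖ).obj B)).app (op c) b

section

variable {C : Type u} [SmallCategory C] (J : GrothendieckTopology C)

theorem CategoryTheory.Sieve.iSup_apply_iff {I : Type*} {c d : C} (S : I → Sieve c) (f : d ⟶ c) :
    (⨆ i, S i) f ↔ ∃ i, S i f := by
  simp [iSup, Sieve.sSup_apply]

theorem isCoseparator_uLift_bool : IsCoseparator (ULift.{u} Bool : Type u) := by
  classical
  rw [isCoseparator_def]
  intro X Y f g h
  ext x
  by_contra hne
  have := ConcreteCategory.congr_hom (h (↾fun y => ULift.up (decide (y = f x)))) x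
  exact hne (by simpa using this.symm : g x = f x).symm

theorem constantSheaf_map_constSection {B : Type u} {c d : C} (f : d ⟶ c) (b : B) :
    ((constantSheaf J (Type u)).obj B).obj.map f.op (constSection J c b) = constSection J d b :=
  (NatTrans.naturality_apply (toSheafify J ((Functor.const Cᵒᵖ).obj B)) f.op b).symm

theorem constantSheaf_map_app_constSection {B B' : Type u} (g : B ⟶ B') (c : C) (b : B) :
    ((constantSheaf J (Type u)).map g).hom.app (op c) (constSection J c b) =
      constSection J c (g b) := by
  have h := toSheafify_naturality J ((Functor.const Cᵒᵖ).map g)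
  exact (ConcreteCategory.congr_hom (NatTrans.congr_app h (op c)) b).symm

variable {J}

theorem eq_or_bot_mem_of_constSection_eq {B : Type u} {c : C} {b b' : B}
    (h : constSection J c b = constSection J c b') : b = b' ∨ (⊥ : Sieve c) ∈ J c := by
  by_cases hb : b = b'
  · exact Or.inl hb
  -- Sheafification is locally injective, and distinct constants agree along no arrow.
  · refine Or.inr (J.superset_covering ?_ (Presheaf.equalizerSieve_mem J
      (toSheafify J ((Functor.const Cᵒᵖ).obj B)) (X := op c) b b' h))
    intro d f hf
    exact hb hf

theorem constSection_eq_of_bot_mem {B : Type u} {c : C} (h : (⊥ : Sieve c) ∈ J c)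
    (s t : ((constantSheaf J (Type u)).obj B).obj.obj (op c)) : s = t :=
  (((isSheaf_iff_isSheaf_of_type _ _).1
    ((constantSheaf J (Type u)).obj B).property).isSeparated _ h).ext fun _ _ hf => hf.elim

theorem constantSheaf_section_ext {B : Type u} {c : C} {R : Sieve c} (hR : R ∈ J c)
    {s t : ((constantSheaf J (Type u)).obj B).obj.obj (op c)}
    (h : ∀ ⦃d : C⦄ (f : d ⟶ c), R f → ((constantSheaf J (Type u)).obj B).obj.map f.op s =
      ((constantSheaf J (Type u)).obj B).obj.map f.op t) : s = t :=
  (((isSheaf_iff_isSheaf_of_type _ _).1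
    ((constantSheaf J (Type u)).obj B).property).isSeparated _ hR).ext h

/-- The sieve of arrows along which the section `s` takes the constant value `b`. -/
def valueSieve {B : Type u} {c : C} (s : ((constantSheaf J (Type u)).obj B).obj.obj (op c))
    (b : B) : Sieve c where
  arrows d f := ((constantSheaf J (Type u)).obj B).obj.map f.op s = constSection J d b
  downward_closed := by
    intro d e f hf g
    rw [op_comp, Functor.map_comp, ConcreteCategory.comp_apply, hf,
      constantSheaf_map_constSection]

theorem valueSieve_isClosed {B : Type u} {c : C}
    (s : ((constantSheaf J (Type u)).obj B).obj.obj (op c)) (b : B) :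
    J.IsClosed (valueSieve s b) := by
  intro d f hf
  refine constantSheaf_section_ext hf fun e g hg => ?_
  rw [constantSheaf_map_constSection]
  simpa [Sieve.pullback_apply, valueSieve] using hg

/-- This is local surjectivity of sheafification. -/
theorem iSup_valueSieve_mem {B : Type u} {c : C}
    (s : ((constantSheaf J (Type u)).obj B).obj.obj (op c)) :
    (⨆ b, valueSieve s b) ∈ J c := by
  refine J.superset_covering ?_
    (Presheaf.imageSieve_mem J (toSheafify J ((Functor.const Cᵒᵖ).obj B)) (U := op c) s)
  rintro d f ⟨b, hb⟩
  rw [Sieve.iSup_apply_iff]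
  exact ⟨b, hb.symm⟩

theorem valueSieve_disjoint {B : Type u} {c : C}
    {s : ((constantSheaf J (Type u)).obj B).obj.obj (op c)} {b b' : B} (hb : b ≠ b')
    {d : C} {f : d ⟶ c} (h : valueSieve s b f) (h' : valueSieve s b' f) :
    (⊥ : Sieve d) ∈ J d :=
  (eq_or_bot_mem_of_constSection_eq (h.symm.trans h')).resolve_left hb

/-- A locally constant family of values on a cover, compatible on nonempty overlaps, glues to a
section of the constant sheaf. -/
theorem exists_section_of_values {B I : Type u} {c : C} {S : I → Sieve c}
    (hS : (⨆ i, S i) ∈ J c) (v : I → B)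
    (hv : ∀ i j ⦃d : C⦄ (f : d ⟶ c), S i f → S j f → v i = v j ∨ (⊥ : Sieve d) ∈ J d) :
    ∃ s : ((constantSheaf J (Type u)).obj B).obj.obj (op c), ∀ i, S i ≤ valueSieve s (v i) := by
  have hsup : ∀ {d : C} {f : d ⟶ c}, (⨆ i, S i) f → ∃ i, S i f := fun h =>
    (Sieve.iSup_apply_iff _ _).1 h
  have key : ∀ i j ⦃d : C⦄ (f : d ⟶ c), S i f → S j f →
      constSection J d (v i) = constSection J d (v j) := fun i j d f hi hj => by
    rcases hv i j f hi hj with h | h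
    · rw [h]
    · exact constSection_eq_of_bot_mem h _ _
  let x : Presieve.FamilyOfElements ((constantSheaf J (Type u)).obj B).obj
      (⨆ i, S i : Sieve c).arrows := fun d f hf => constSection J d (v (hsup hf).choose)
  have hx : x.Compatible := by
    rw [Presieve.compatible_iff_sieveCompatible]
    intro d e f g hf
    simp only [x]
    rw [constantSheaf_map_constSection]
    exact key _ _ (g ≫ f) (hsup (Sieve.downward_closed _ hf g)).choose_spec ((S _).downward_closed (hsup hf).choose_spec g)
  have hsh := ((isSheaf_iff_isSheaf_of_type _ _).1
    ((constantSheaf J (Type u)).obj B).property) _ hS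
  refine ⟨hsh.amalgamate x hx, fun i d f hf => ?_⟩
  have hf' : (⨆ i, S i) f := by
    rw [Sieve.iSup_apply_iff]
    exact ⟨i, hf⟩
  exact (hsh.valid_glue hx f hf').trans (key _ _ f (hsup hf').choose_spec hf)

theorem valueSieve_le_valueSieve_map {B B' : Type u} {c : C}
    (s : ((constantSheaf J (Type u)).obj B).obj.obj (op c)) (g : B ⟶ B') (b : B) :
    valueSieve s b ≤ valueSieve (((constantSheaf J (Type u)).map g).hom.app (op c) s) (g b) := by
  intro d f hf
  change ((constantSheaf J (Type u)).obj B').obj.map f.op _ = _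
  rw [← NatTrans.naturality_apply, show ((constantSheaf J (Type u)).obj B).obj.map f.op s =
    constSection J d b from hf, constantSheaf_map_app_constSection]

theorem section_ext_of_valueSieve {B I : Type u} {c : C} {S : I → Sieve c}
    (hS : (⨆ i, S i) ∈ J c) {s t : ((constantSheaf J (Type u)).obj B).obj.obj (op c)} (v : I → B)
    (hs : ∀ i, S i ≤ valueSieve s (v i)) (ht : ∀ i, S i ≤ valueSieve t (v i)) : s = t := by
  refine constantSheaf_section_ext hS fun d f hf => ?_
  rw [Sieve.iSup_apply_iff] at hf
  obtain ⟨i, hi⟩ := hf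
  exact (hs i _ hi).trans (ht i _ hi).symm

/-- An indecomposable sieve contains an arrow whose domain is not covered by the empty sieve. -/
theorem IsIndecomposableSieve.exists_bot_notMem {c : C} {S : Sieve c}
    (hS : IsIndecomposableSieve J S) : ∃ (d : C) (f : d ⟶ c), S f ∧ (⊥ : Sieve d) ∉ J d := by
  by_contra! h
  -- Otherwise the empty family would have dense union.
  obtain ⟨i, -⟩ := hS PEmpty (fun i => i.elim) (fun i => i.elim) (fun i => i.elim)
    fun d f hf => J.superset_covering bot_le (h d f hf)
  exact i.elim

/-- Every section of a constant sheaf is constant on an indecomposable sieve. -/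
theorem IsIndecomposableSieve.exists_le_valueSieve {B : Type u} {c : C} {S : Sieve c}
    (hS : IsIndecomposableSieve J S)
    (s : ((constantSheaf J (Type u)).obj B).obj.obj (op c)) : ∃ b, S ≤ valueSieve s b := by
  obtain ⟨b, hb⟩ := hS B (fun b => S ⊓ valueSieve s b) (fun _ => inf_le_left)
    (fun b b' hb d f h h' => valueSieve_disjoint hb h.2 h'.2) (by
      intro d f hf
      refine J.superset_covering ?_ (J.pullback_stable f (iSup_valueSieve_mem s))
      intro e g hg
      simp only [Sieve.pullback_apply, Sieve.iSup_apply_iff] at hg ⊢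
      obtain ⟨b, hb⟩ := hg
      exact ⟨b, S.downward_closed hf g, hb⟩)
  refine ⟨b, fun d f hf => valueSieve_isClosed s b f ?_⟩
  exact J.superset_covering (Sieve.pullback_monotone f inf_le_right) (hb f hf)

/-- If `c` is covered by indecomposable sieves, then taking sections over `c` of constant sheaves is
corepresented by the set of connected components of `c`. -/
theorem isCorepresentable_constantSheaf_sections {c : C} {I : Type u} {S : I → Sieve c}
    (hI : ∀ i, IsIndecomposableSieve J (S i)) (hS : (⨆ i, S i) ∈ J c) :
    (constantSheaf J (Type u) ⋙ (sheafSections J (Type u)).obj (op c)).IsCorepresentable := by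
  -- Nondegenerate overlap; `Quot r` is the set of connected components.
  let r : I → I → Prop := fun i j => ∃ (d : C) (f : d ⟶ c), S i f ∧ S j f ∧ (⊥ : Sieve d) ∉ J d
  have hex : ∀ {B : Type u} (v : Quot r ⟶ B),
      ∃ s : ((constantSheaf J (Type u)).obj B).obj.obj (op c),
        ∀ i, S i ≤ valueSieve s (v (Quot.mk r i)) := fun v =>
    exists_section_of_values hS (fun i => v (Quot.mk r i)) fun i j d f hi hj => by
      by_cases hd : (⊥ : Sieve d) ∈ J d
      · exact Or.inr hd
      · exact Or.inl (congrArg _ (Quot.sound ⟨d, f, hi, hj, hd⟩))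
  choose glue hglue using @hex
  have hbij : ∀ B : Type u, Function.Bijective (glue (B := B)) := by
    refine fun B => ⟨fun v w h => ?_, fun s => ?_⟩
    · ext x
      induction x using Quot.ind with | mk i => ?_
      obtain ⟨d, f, hf, hd⟩ := (hI i).exists_bot_notMem
      by_contra hne
      refine hd (valueSieve_disjoint hne (hglue v i _ hf) ?_)
      rw [h]
      exact hglue w i _ hf
    · choose b hb using fun i => (hI i).exists_le_valueSieve s
      refine ⟨↾(Quot.lift b ?_), ?_⟩
      · rintro i j ⟨d, f, hi, hj, hd⟩
        by_contra hne
        exact hd (valueSieve_disjoint hne (hb i _ hi) (hb j _ hj))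
      · exact section_ext_of_valueSieve hS b (hglue _) hb
  exact ⟨Quot r, ⟨{
    homEquiv := fun {B} => Equiv.ofBijective _ (hbij B)
    homEquiv_comp := fun {B B'} g v =>
      section_ext_of_valueSieve hS (fun i => g (v (Quot.mk r i))) (hglue _)
        fun i => (hglue v i).trans (valueSieve_le_valueSieve_map _ g _) }⟩⟩

theorem isLocallyConnected_of_indecomposable_cover
    (h : ∀ c : C, ∃ (I : Type u) (S : I → Sieve c),
      (∀ i, IsIndecomposableSieve J (S i)) ∧ (⨆ i, S i) ∈ J c) :
    IsLocallyConnectedSheafTopos J := by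
  have : PreservesLimits (constantSheaf J (Type u) ⋙ sheafToPresheaf J (Type u)) := by
    refine preservesLimits_of_evaluation _ fun X => ?_
    obtain ⟨I, S, hI, hS⟩ := h X.unop
    have := isCorepresentable_constantSheaf_sections hI hS
    exact inferInstanceAs (PreservesLimits
      (constantSheaf J (Type u) ⋙ (sheafSections J (Type u)).obj X))
  have : PreservesLimits (constantSheaf J (Type u)) :=
    preservesLimits_of_reflects_of_preserves _ (sheafToPresheaf J (Type u))
  exact isRightAdjoint_of_preservesLimits_of_isCoseparating
    isCoseparator_uLift_bool
    (constantSheaf J (Type u))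

/-- If the constant sheaf functor has a left adjoint, there is a universal section over `c` of a
constant sheaf. -/
theorem exists_universal_section (h : IsLocallyConnectedSheafTopos J) (c : C) :
    ∃ (A : Type u) (s : ((constantSheaf J (Type u)).obj A).obj.obj (op c)),
      ∀ (B : Type u) (t : ((constantSheaf J (Type u)).obj B).obj.obj (op c)),
        ∃ g : A ⟶ B, ((constantSheaf J (Type u)).map g).hom.app (op c) s = t := by
  have : (constantSheaf J (Type u)).IsRightAdjoint := h
  -- Evaluation at `c` is also a right adjoint, so `G` is one; the unit at a point is the universal
  -- section.
  let G : Type u ⥤ Type u := (constantSheaf J (Type u) ⋙ sheafToPresheaf J (Type u)) ⋙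
    (evaluation Cᵒᵖ (Type u)).obj (op c)
  let adj := Adjunction.ofIsRightAdjoint G
  refine ⟨G.leftAdjoint.obj PUnit, adj.unit.app PUnit PUnit.unit, fun B t => ?_⟩
  refine ⟨(adj.homEquiv PUnit B).symm (↾fun _ => t), ?_⟩
  have := (adj.homEquiv PUnit B).apply_symm_apply (↾fun _ => t)
  rw [adj.homEquiv_unit] at this
  exact ConcreteCategory.congr_hom this PUnit.unit

/-- A splitting `T` of one piece gives a section `t` with values in `Option I`: `some i` on `T i`,
`none` on the other pieces. By universality `t` is constant on the given piece, so at most one `T i`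
is nondegenerate. -/
theorem valueSieve_isIndecomposable {A : Type u} {c : C}
    {s : ((constantSheaf J (Type u)).obj A).obj.obj (op c)}
    (hs : ∀ (B : Type u) (t : ((constantSheaf J (Type u)).obj B).obj.obj (op c)),
        ∃ g : A ⟶ B, ((constantSheaf J (Type u)).map g).hom.app (op c) s = t)
    {a : A} (ha : ∃ (d : C) (f : d ⟶ c), valueSieve s a f ∧ (⊥ : Sieve d) ∉ J d) :
    IsIndecomposableSieve J (valueSieve s a) := by
  classical
  intro I T hle hdisj hdense
  let S : I ⊕ {b : A // b ≠ a} → Sieve c := Sum.elim T fun b => valueSieve s b.1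
  let v : I ⊕ {b : A // b ≠ a} → Option I := Sum.elim some fun _ => none
  have hcov : (⨆ i, S i) ∈ J c := by
    refine J.transitive (iSup_valueSieve_mem s) _ fun d f hf => ?_
    rw [Sieve.iSup_apply_iff] at hf
    obtain ⟨b, hb⟩ := hf
    by_cases hba : b = a
    · subst hba
      exact J.superset_covering (Sieve.pullback_monotone f
        (iSup_le fun i => le_iSup S (Sum.inl i))) (hdense f hb)
    · exact J.superset_covering (Sieve.pullback_monotone f
        (le_iSup S (Sum.inr ⟨b, hba⟩))) (by
          change (valueSieve s b).pullback f ∈ J d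
          rw [(Sieve.mem_iff_pullback_eq_top _).1 hb]
          exact J.top_mem d)
  obtain ⟨t, ht⟩ := exists_section_of_values hcov v (by
    rintro (i | ⟨b, hb⟩) (j | ⟨b', hb'⟩) d f hi hj
    · by_cases hij : i = j
      · exact Or.inl (congrArg some hij)
      · exact Or.inr (hdisj i j hij f hi hj)
    · exact Or.inr (valueSieve_disjoint hb' hj (hle i _ hi))
    · exact Or.inr (valueSieve_disjoint hb hi (hle j _ hj))
    · exact Or.inl rfl)
  obtain ⟨g, rfl⟩ := hs _ t
  have hga := valueSieve_le_valueSieve_map s g a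
  have hbot : ∀ (i : I), g a ≠ some i → ∀ ⦃d : C⦄ (f : d ⟶ c), T i f → (⊥ : Sieve d) ∈ J d :=
    fun i hi d f hf => valueSieve_disjoint hi (hga _ (hle i _ hf)) (ht (Sum.inl i) _ hf)
  rcases hk : g a with _ | k
  -- The value `none` would make every `T i`, hence the whole piece, degenerate.
  · obtain ⟨d, f, hf, hd⟩ := ha
    refine absurd (J.transitive (hdense f hf) _ fun e h he => ?_) hd
    rw [Sieve.pullback_apply, Sieve.iSup_apply_iff] at he
    obtain ⟨i, hi⟩ := he
    exact J.superset_covering bot_le (hbot i (by simp [hk]) _ hi)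
  · refine ⟨k, fun d f hf => J.transitive (hdense f hf) _ fun e h he => ?_⟩
    rw [Sieve.pullback_apply, Sieve.iSup_apply_iff] at he
    obtain ⟨i, hi⟩ := he
    by_cases hik : i = k
    · subst hik
      rw [← Sieve.pullback_comp, (Sieve.mem_iff_pullback_eq_top _).1 hi]
      exact J.top_mem e
    · exact J.superset_covering bot_le (hbot i (by simpa [hk] using Ne.symm hik) _ hi)

theorem exists_indecomposable_cover (h : IsLocallyConnectedSheafTopos J) (c : C) :
    ∃ (I : Type u) (S : I → Sieve c),
      (∀ i, J.IsClosed (S i) ∧ IsIndecomposableSieve J (S i)) ∧ (⨆ i, S i) ∈ J c := by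
  obtain ⟨A, s, hs⟩ := exists_universal_section h c
  -- Degenerate pieces are not indecomposable; dropping them keeps the cover.
  refine ⟨{a : A // ∃ (d : C) (f : d ⟶ c), valueSieve s a f ∧ (⊥ : Sieve d) ∉ J d},
    fun a => valueSieve s a.1,
    fun a => ⟨valueSieve_isClosed s a.1, valueSieve_isIndecomposable hs a.2⟩, ?_⟩
  refine J.transitive (iSup_valueSieve_mem s) _ fun d f hf => ?_
  rw [Sieve.iSup_apply_iff] at hf
  obtain ⟨a, ha⟩ := hf
  by_cases hd : (⊥ : Sieve d) ∈ J d
  · exact J.superset_covering bot_le hd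
  · refine J.superset_covering (Sieve.pullback_monotone f (le_iSup
      (fun a : {a : A // ∃ (d : C) (f : d ⟶ c), valueSieve s a f ∧ (⊥ : Sieve d) ∉ J d} =>
        valueSieve s a.1) ⟨a, d, f, ha, hd⟩)) ?_
    rw [(Sieve.mem_iff_pullback_eq_top _).1 ha]
    exact J.top_mem d

end

theorem theorem5p3 {C : Type u} [SmallCategory C] (J : GrothendieckTopology C) :
    IsLocallyConnectedSheafTopos J ↔
      ∀ c : C, ∃ (I : Type u) (S : I → Sieve c),
        (∀ i, J.IsClosed (S i) ∧ IsIndecomposableSieve J (S i)) ∧ (⨆ i, S i) ∈ J c :=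
  ⟨exists_indecomposable_cover, fun h => isLocallyConnected_of_indecomposable_cover fun c =>
    let ⟨I, S, hI, hS⟩ := h c
    ⟨I, S, fun i => (hI i).2, hS⟩⟩
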